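/- **Model.** Let $\mathcal V$ be a finite vocabulary of $n \ge d$ words, each word $w$ being represented by a vector $\vec w\in\mathbb R^d$. A text is generated by a random walk of discourse vectors $c_0,c_1,\dots$ on the unit sphere of $\mathbb R^d$: the walk is a stationary time-homogeneous Markov chain whose stationary distribution $\mathcal C$ is the uniform distribution on the sphere, and it is slow, i.e. $\|c_{t+1}-c_t\|_2\le \epsilon_2/\sqrt d$ almost surely, for some $\epsilon_2\ge 0$. Given the whole walk and the words emitted before time $t$, the word emitted at time $t$ is $w$ with probability $\exp(\langle \vec w,c_t\rangle)/Z_{c_t}$, where $Z_c=\sum_{w\in\mathcal V}\exp(\langle \vec w,c\rangle)$ is the partition function. Let $p(w_1,\dots,w_k)$ be the probability that the words emitted at $k$ given consecutive times are $w_1,\dots,w_k$. **Theorem.** Let $\kappa>0$ and $a>0$ be constants. There are a constant $C>0$ and an exponent $m\in\mathbb N$, depending only on $\kappa$ and $a$, such that for every $k$ there is a $d_0$ (depending on $k,\kappa,a$) for which the following holds for all $d\ge d_0$, all $n\ge d$ and every model as above. Suppose that $\|\vec w\|_2\le\kappa\sqrt d$ for all $w\in\mathcal V$, and that the partition function concentrates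 around a constant $Z>0$: for some $0\le\epsilon_z\le\frac12$, $$\Pr_{c\sim\mathcal C}\bigl[(1-\epsilon_z)Z\le Z_c\le(1+\epsilon_z)Z\bigr]\ \ge\ 1-\exp(-a\log^2 n).$$ Then for all words $w_1,\dots,w_k\in\mathcal V$, $p(w_1,\dots,w_k)>0$ and $$\left|\log p(w_1,\dots,w_k)-\left(\frac{\bigl\|\sum_{i=1}^k\vec w_i\bigr\|_2^2}{2d}-k\log Z\right)\right|\ \le\ C\,k\,\epsilon_z+C\,\frac{\log^m d}{d}+C\,k^2\epsilon_2 .$$ That is, the error is $O(k\epsilon_z)+\widetilde O(1/d)+O(k^2\epsilon_2)$, and the normalising constant $Z$ does not depend on the words $w_1,\dots,w_k$. -/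

import Mathlib

open MeasureTheory ProbabilityTheory
open scoped RealInnerProductSpace

noncomputable section

/-- The unit sphere of `ℝ^d` with the Euclidean norm: the space of discourse vectors. -/
abbrev DiscourseSphere (d : ℕ) : Type :=
  Metric.sphere (0 : EuclideanSpace ℝ (Fin d)) 1

/-- The uniform probability distribution on the unit sphere of `ℝ^d` (`d ≥ 1`): the surface
measure induced by Lebesgue measure, normalised to total mass one. -/
def uniformSphere (d : ℕ) : Measure (DiscourseSphere d) :=
  ((volume : Measure (EuclideanSpace ℝ (Fin d))).toSphere Set.univ)⁻¹ •
    (volume : Measure (EuclideanSpace ℝ (Fin d))).toSphere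

/-- The partition function `Z_c = ∑_{w ∈ V} exp ⟨w, c⟩` of the word vectors `v` at the
discourse `c`. -/
def partitionFn {d : ℕ} {V : Type*} [Fintype V] (v : V → EuclideanSpace ℝ (Fin d))
    (c : DiscourseSphere d) : ℝ :=
  ∑ w, Real.exp ⟪v w, (c : EuclideanSpace ℝ (Fin d))⟫

/-- The probability, proportional to `exp ⟨w, c⟩`, of emitting the word `w` under the
discourse `c`. -/
def emissionProb {d : ℕ} {V : Type*} [Fintype V] (v : V → EuclideanSpace ℝ (Fin d))
    (c : DiscourseSphere d) (w : V) : ℝ :=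
  Real.exp ⟪v w, (c : EuclideanSpace ℝ (Fin d))⟫ / partitionFn v c

/-- Concentration of the partition function around the constant `Z`: for `c` uniform on the
sphere, `(1 - εz) Z ≤ Z_c ≤ (1 + εz) Z` holds with probability at least `1 - δ`. -/
def PartitionConcentrates {d : ℕ} {V : Type*} [Fintype V]
    (v : V → EuclideanSpace ℝ (Fin d)) (Z εz δ : ℝ) : Prop :=
  1 - δ ≤ (uniformSphere d).real
    {c | (1 - εz) * Z ≤ partitionFn v c ∧ partitionFn v c ≤ (1 + εz) * Z}

/-- The sigma-algebra generated by the discourse vectors at times `0, …, t`. -/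
@[reducible]
def walkPast {d : ℕ} {Ω : Type*} (c : ℕ → Ω → DiscourseSphere d) (t : ℕ) : MeasurableSpace Ω :=
  ⨆ s, ⨆ (_ : s ≤ t), MeasurableSpace.comap (c s) inferInstance

/-- The sigma-algebra generated by the whole discourse walk and by the words emitted strictly
before time `t`. -/
@[reducible]
def walkAndWordsBefore {d : ℕ} {V Ω : Type*} [MeasurableSpace V]
    (c : ℕ → Ω → DiscourseSphere d) (W : ℕ → Ω → V) (t : ℕ) : MeasurableSpace Ω :=
  (⨆ s, MeasurableSpace.comap (c s) inferInstance) ⊔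
    ⨆ s, ⨆ (_ : s < t), MeasurableSpace.comap (W s) inferInstance

/-- The random-walk model of text generation: on the probability space `(Ω, μ)`, `c` is the
walk of the discourse vectors, with transition kernel `P`, and `W` is the text. -/
structure IsRandomWalkModel {d : ℕ} {V Ω : Type*} [Fintype V] [MeasurableSpace V]
    [MeasurableSpace Ω]
    (v : V → EuclideanSpace ℝ (Fin d)) (ε₂ : ℝ)
    (P : Kernel (DiscourseSphere d) (DiscourseSphere d)) (μ : Measure Ω)
    (c : ℕ → Ω → DiscourseSphere d) (W : ℕ → Ω → V) : Prop where
  measurable_walk : ∀ t, Measurable (c t)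
  measurable_word : ∀ t, Measurable (W t)
  /-- The uniform distribution on the sphere is stationary for the walk. -/
  stationary : P.Invariant (uniformSphere d)
  /-- The walk starts in its stationary distribution. -/
  law_zero : μ.map (c 0) = uniformSphere d
  /-- The walk is a Markov chain with transition kernel `P`. -/
  markov : ∀ t, ∀ B : Set (DiscourseSphere d), MeasurableSet B →
    μ⟦c (t + 1) ⁻¹' B | walkPast c t⟧ =ᵐ[μ] fun ω => (P (c t ω)).real B
  /-- The walk is slow. -/
  slow : ∀ t, ∀ᵐ ω ∂μ,
    ‖(c (t + 1) ω : EuclideanSpace ℝ (Fin d)) - c t ω‖ ≤ ε₂ / √(d : ℝ)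
  /-- Given the walk and the previous words, the word at time `t` is emitted with probability
  proportional to `exp ⟨w, c_t⟩`. -/
  emission : ∀ t, ∀ w : V,
    μ⟦W t ⁻¹' {w} | walkAndWordsBefore c W t⟧ =ᵐ[μ] fun ω => emissionProb v (c t ω) w

/-- The joint probability `p(w_1, …, w_k)` that the `k` consecutive words emitted from time `s`
on are `w_1, …, w_k`. -/
def jointProb {V Ω : Type*} [MeasurableSpace Ω] (μ : Measure Ω) (W : ℕ → Ω → V) (s : ℕ)
    {k : ℕ} (u : Fin k → V) : ℝ :=
  μ.real {ω | ∀ i : Fin k, W (s + i) ω = u i}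

end

/-! Conditionally on the walk the words are independent, so the joint probability is the mean of a
product of `emissionProb` along the walk (`setIntegral_words`, `jointProb_eq`). In `k` steps the
walk drifts by at most `k ε₂ / √d`. Cauchy–Schwarz then bounds the change of each logit by `κ k ε₂`,
so evaluating all `k` words at `c s` costs `κ k² ε₂` in the exponent. Where all `k` partition
functions lie within a factor `1 ± εz` of `Z`, the product is therefore close to `exp ⟪S, c s⟫ / Z ^
k`, with `S` the sum of the word vectors and `c s` uniform on the sphere (`map_walk`).

The mean of `exp ⟪S, c⟫` is computed from moments. Gaussian integration by parts in polar
coordinates gives the recursion `integral_inner_pow_uniformSphere_succ`. Compared with the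
exponential series of `l = ‖S‖² / (2d)`, it places the mean between `exp l * (1 - l² / d)` and `exp
l`. Since `l ≤ k² κ² / 2` is bounded independently of `d`, the error is of order `1/d`.

The exceptional event has probability at most `k δ`, with `δ = exp (-a log² n)`. In the upper bound
the product there is at most `1`, and `k δ` is negligible against `Z ^ (-k)` because `Z` is at most
a constant times `n`. In the lower bound the mass of `exp ⟪S, c⟫` on that event is controlled by its
second moment. -/

open Measure Module

/-! ### Gaussian integrals and polar coordinates -/

/-- Integration in polar coordinates of a function that separates into an angular and a radial
factor. -/
theorem integral_polar {d : ℕ} (hd : 0 < d) (F : EuclideanSpace ℝ (Fin d) → ℝ)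
    (f : DiscourseSphere d → ℝ) (g : ℝ → ℝ)
    (hF : ∀ (x : DiscourseSphere d) (r : ℝ), 0 < r →
      F (r • (x : EuclideanSpace ℝ (Fin d))) = f x * g r) :
    ∫ x, F x = (∫ x, f x ∂(volume : Measure (EuclideanSpace ℝ (Fin d))).toSphere) *
      ∫ y in Set.Ioi (0 : ℝ), y ^ (d - 1) * g y := by
  have : Nonempty (Fin d) := ⟨⟨0, hd⟩⟩
  have key : ∀ z : Set.Ioi (0 : ℝ), 0 < (z : ℝ) := fun z => z.2
  calc
    ∫ x, F x = ∫ x : ({(0)}ᶜ : Set (EuclideanSpace ℝ (Fin d))), F x.1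
        ∂(volume.comap (Subtype.val :
          ({(0)}ᶜ : Set (EuclideanSpace ℝ (Fin d))) → EuclideanSpace ℝ (Fin d))) := by
      rw [integral_subtype_comap (measurableSet_singleton _).compl fun x ↦ F x,
        restrict_compl_singleton]
    _ = ∫ z, f z.1 * g z.2 ∂(volume : Measure (EuclideanSpace ℝ (Fin d))).toSphere.prod
          (.volumeIoiPow (finrank ℝ (EuclideanSpace ℝ (Fin d)) - 1)) := by
      rw [← (volume : Measure
        (EuclideanSpace ℝ (Fin d))).measurePreserving_homeomorphUnitSphereProd.integral_comp
        (Homeomorph.measurableEmbedding _)]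
      congr 1
      ext x
      rw [← hF _ _ (key _)]
      congr 1
      have hx : ‖(x : EuclideanSpace ℝ (Fin d))‖ ≠ 0 := norm_ne_zero_iff.2 x.2
      simp [smul_smul, hx]
    _ = (∫ x, f x ∂(volume : Measure (EuclideanSpace ℝ (Fin d))).toSphere) *
        ∫ x : Set.Ioi (0 : ℝ), g x ∂.volumeIoiPow
          (finrank ℝ (EuclideanSpace ℝ (Fin d)) - 1) :=
      integral_prod_mul f (fun x : Set.Ioi (0 : ℝ) => g x)
    _ = _ := by
      simp only [Measure.volumeIoiPow, ENNReal.ofReal, finrank_euclideanSpace, Fintype.card_fin]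
      rw [integral_withDensity_eq_integral_smul,
        integral_subtype_comap measurableSet_Ioi fun a ↦ Real.toNNReal (a ^ (d - 1)) • g a,
        setIntegral_congr_fun measurableSet_Ioi fun x hx ↦ ?_]
      · rw [NNReal.smul_def, Real.coe_toNNReal _ (pow_nonneg (le_of_lt hx) _), smul_eq_mul]
      · exact (measurable_subtype_coe.pow_const _).real_toNNReal

/-- Moments of the radial Gaussian weight. -/
theorem integral_pow_mul_exp_neg_sq (q : ℕ) :
    ∫ y in Set.Ioi (0 : ℝ), y ^ q * Real.exp (-y ^ 2) =
      1 / 2 * Real.Gamma (((q : ℝ) + 1) / 2) := by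
  have h := integral_rpow_mul_exp_neg_rpow (p := 2) (q := (q : ℝ)) two_pos
    (by have : (0 : ℝ) ≤ q := q.cast_nonneg
        linarith)
  simpa using h

/-- A power is dominated by `n! (exp y + exp (-y))`, and a Gaussian with a linear tilt is
integrable. -/
theorem integrable_inner_pow_mul_exp {E : Type*} [NormedAddCommGroup E] [InnerProductSpace ℝ E]
    [FiniteDimensional ℝ E] [MeasurableSpace E] [BorelSpace E] (S : E) (n : ℕ) :
    Integrable fun x : E => ⟪S, x⟫ ^ n * Real.exp (-‖x‖ ^ 2) := by
  have h1 : ∀ c : ℝ, Integrable fun x : E => Real.exp (-‖x‖ ^ 2 + c * ⟪S, x⟫) := fun c => by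
    have h := (GaussianFourier.integrable_cexp_neg_mul_sq_norm_add (V := E) (b := 1)
      (by simp) (c : ℂ) S).norm
    refine h.congr (ae_of_all _ fun x => ?_)
    simp only [Complex.norm_exp]
    congr 1
    norm_cast
    simp
  have h2 := ((h1 1).add (h1 (-1))).const_mul (n.factorial : ℝ)
  refine h2.mono' (by fun_prop) (ae_of_all _ fun x => ?_)
  have h3 : |⟪S, x⟫| ^ n ≤ n.factorial * Real.exp |⟪S, x⟫| := by
    have := Real.pow_div_factorial_le_exp |⟪S, x⟫| (abs_nonneg _) n
    rwa [div_le_iff₀ (by positivity), mul_comm] at this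
  have h4 : Real.exp |⟪S, x⟫| ≤ Real.exp ⟪S, x⟫ + Real.exp (-⟪S, x⟫) := by
    rcases abs_choice ⟪S, x⟫ with h | h <;> rw [h] <;>
      linarith [Real.exp_pos ⟪S, x⟫, Real.exp_pos (-⟪S, x⟫)]
  rw [norm_mul, norm_pow, Real.norm_eq_abs, Real.norm_of_nonneg (Real.exp_pos _).le]
  simp only [Pi.add_apply, Real.exp_add, one_mul, neg_one_mul]
  calc |⟪S, x⟫| ^ n * Real.exp (-‖x‖ ^ 2)
      ≤ (n.factorial * (Real.exp ⟪S, x⟫ + Real.exp (-⟪S, x⟫))) * Real.exp (-‖x‖ ^ 2) := by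
        gcongr
        exact h3.trans (by gcongr)
    _ = _ := by ring

/-- Integration by parts in the direction `S`. At `n = 0` the truncated exponent `n - 1` is
harmless, its coefficient being zero; that case yields the vanishing mean on the sphere. -/
theorem integral_inner_pow_mul_exp_succ {E : Type*} [NormedAddCommGroup E]
    [InnerProductSpace ℝ E] [FiniteDimensional ℝ E] [MeasurableSpace E] [BorelSpace E]
    (S : E) (n : ℕ) :
    2 * ∫ x : E, ⟪S, x⟫ ^ (n + 1) * Real.exp (-‖x‖ ^ 2) =
      n * ‖S‖ ^ 2 * ∫ x : E, ⟪S, x⟫ ^ (n - 1) * Real.exp (-‖x‖ ^ 2) := by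
  have hf : ∀ x : E, HasFDerivAt (fun x : E => ⟪S, x⟫ ^ n)
      (((n : ℝ) * ⟪S, x⟫ ^ (n - 1)) • innerSL ℝ S) x := fun x => by
    have := ((innerSL ℝ S).hasFDerivAt (x := x)).pow n
    simpa using this
  have hg : ∀ x : E, HasFDerivAt (fun x : E => Real.exp (-‖x‖ ^ 2))
      ((-2 * Real.exp (-‖x‖ ^ 2)) • innerSL ℝ x) x := fun x => by
    refine ((hasStrictFDerivAt_norm_sq x).hasFDerivAt.neg).exp.congr_fderiv ?_
    simp only [Pi.neg_apply]
    module
  have e1 : ∀ x : E, ⟪S, x⟫ ^ n * ((-2 * Real.exp (-‖x‖ ^ 2)) • innerSL ℝ x) S =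
      (-2) * (⟪S, x⟫ ^ (n + 1) * Real.exp (-‖x‖ ^ 2)) := fun x => by
    simp [real_inner_comm S x]; ring
  have e2 : ∀ x : E, (((n : ℝ) * ⟪S, x⟫ ^ (n - 1)) • innerSL ℝ S) S * Real.exp (-‖x‖ ^ 2) =
      (n * ‖S‖ ^ 2) * (⟪S, x⟫ ^ (n - 1) * Real.exp (-‖x‖ ^ 2)) := fun x => by
    simp; ring
  have h := integral_bilinear_hasFDerivAt_right_eq_neg_left_of_integrable (μ := volume)
    (B := ContinuousLinearMap.mul ℝ ℝ) (v := S) (f := fun x : E => ⟪S, x⟫ ^ n)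
    (g := fun x : E => Real.exp (-‖x‖ ^ 2))
    (f' := fun x => ((n : ℝ) * ⟪S, x⟫ ^ (n - 1)) • innerSL ℝ S)
    (g' := fun x => (-2 * Real.exp (-‖x‖ ^ 2)) • innerSL ℝ x)
    (by simp only [ContinuousLinearMap.mul_apply', e2]
        exact (integrable_inner_pow_mul_exp S _).const_mul _)
    (by simp only [ContinuousLinearMap.mul_apply', e1]
        exact (integrable_inner_pow_mul_exp S _).const_mul _)
    (integrable_inner_pow_mul_exp S n)
    (fun x _ => hf x) (fun x _ => hg x)
  simp only [ContinuousLinearMap.mul_apply', e1, e2, integral_const_mul] at h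
  linarith

/-! ### Moments and exponential integrals on the sphere -/

theorem isProbabilityMeasure_uniformSphere {d : ℕ} (hd : 0 < d) :
    IsProbabilityMeasure (uniformSphere d) := by
  have : Nonempty (Fin d) := ⟨⟨0, hd⟩⟩
  refine ⟨?_⟩
  rw [uniformSphere, Measure.smul_apply, smul_eq_mul]
  refine ENNReal.inv_mul_cancel ?_ (measure_ne_top _ _)
  rw [Measure.measure_univ_ne_zero]
  exact Measure.toSphere_ne_zero _

theorem integral_uniformSphere {d : ℕ} (f : DiscourseSphere d → ℝ) :
    ∫ x, f x ∂uniformSphere d =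
      ((volume : Measure (EuclideanSpace ℝ (Fin d))).toSphere.real Set.univ)⁻¹ *
        ∫ x, f x ∂(volume : Measure (EuclideanSpace ℝ (Fin d))).toSphere := by
  rw [uniformSphere, integral_smul_measure, ENNReal.toReal_inv, smul_eq_mul, Measure.real]

/-- The moments of a linear functional under the uniform distribution on the sphere. -/
theorem integral_inner_pow_uniformSphere_succ {d : ℕ} (hd : 0 < d)
    (S : EuclideanSpace ℝ (Fin d)) (n : ℕ) :
    (d + n : ℝ) * ∫ c, ⟪S, (c : EuclideanSpace ℝ (Fin d))⟫ ^ (n + 2) ∂uniformSphere d =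
      (n + 1) * ‖S‖ ^ 2 *
        ∫ c, ⟪S, (c : EuclideanSpace ℝ (Fin d))⟫ ^ n ∂uniformSphere d := by
  have hp : ∀ m : ℕ, ∫ x : EuclideanSpace ℝ (Fin d), ⟪S, x⟫ ^ m * Real.exp (-‖x‖ ^ 2) =
      (∫ c, ⟪S, (c : EuclideanSpace ℝ (Fin d))⟫ ^ m
        ∂(volume : Measure (EuclideanSpace ℝ (Fin d))).toSphere) *
        (1 / 2 * Real.Gamma (((d + m : ℕ) : ℝ) / 2)) := fun m => by
    rw [integral_polar hd _ (fun c => ⟪S, (c : EuclideanSpace ℝ (Fin d))⟫ ^ m)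
      (fun r => r ^ m * Real.exp (-r ^ 2))]
    · congr 1
      have := integral_pow_mul_exp_neg_sq (d - 1 + m)
      simp only [pow_add, mul_assoc] at this
      rw [this]
      congr 3
      push_cast [Nat.cast_sub (show 1 ≤ d from hd)]
      ring
    · intro x r hr
      have hx : ‖(x : EuclideanSpace ℝ (Fin d))‖ = 1 := by simp
      rw [inner_smul_right, norm_smul, hx, mul_one, Real.norm_of_nonneg hr.le]
      ring
  -- By `hp` the radial factors of the Gaussian moments of orders `n + 2` and `n` are Gamma values
  -- whose arguments differ by `1`; their ratio `(d + n) / 2` is the source of the factor `d + n`.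
  have h := integral_inner_pow_mul_exp_succ S (n + 1)
  rw [hp, Nat.add_sub_cancel, hp] at h
  have hG : Real.Gamma (((d + (n + 1 + 1) : ℕ) : ℝ) / 2) =
      ((d + n : ℝ) / 2) * Real.Gamma (((d + n : ℕ) : ℝ) / 2) := by
    have hd' : (0 : ℝ) < d := by exact_mod_cast hd
    push_cast
    rw [← Real.Gamma_add_one (by positivity)]
    congr 1
    ring
  have hpos : 0 < Real.Gamma (((d + n : ℕ) : ℝ) / 2) := by
    apply Real.Gamma_pos_of_pos
    have : (0 : ℝ) < ((d + n : ℕ) : ℝ) := by exact_mod_cast (by omega)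
    positivity
  rw [hG] at h
  rw [integral_uniformSphere, integral_uniformSphere]
  have h' : (d + n : ℝ) * (∫ c, ⟪S, (c : EuclideanSpace ℝ (Fin d))⟫ ^ (n + 2)
        ∂(volume : Measure (EuclideanSpace ℝ (Fin d))).toSphere) =
      (n + 1) * ‖S‖ ^ 2 * ∫ c, ⟪S, (c : EuclideanSpace ℝ (Fin d))⟫ ^ n
        ∂(volume : Measure (EuclideanSpace ℝ (Fin d))).toSphere := by
    apply mul_right_cancel₀ hpos.ne'
    push_cast at h ⊢
    linarith
  linear_combination
    ((volume : Measure (EuclideanSpace ℝ (Fin d))).toSphere.real Set.univ)⁻¹ * h'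

theorem integral_inner_uniformSphere {d : ℕ} (hd : 0 < d) (S : EuclideanSpace ℝ (Fin d)) :
    ∫ c, ⟪S, (c : EuclideanSpace ℝ (Fin d))⟫ ∂uniformSphere d = 0 := by
  have h := integral_inner_pow_mul_exp_succ S 0
  rw [integral_polar hd _ (fun c => ⟪S, (c : EuclideanSpace ℝ (Fin d))⟫)
      (fun r => r * Real.exp (-r ^ 2))] at h
  · have h2 := integral_pow_mul_exp_neg_sq (d - 1 + 1)
    simp only [pow_add, mul_assoc, pow_one] at h2
    rw [h2] at h
    have hpos : 0 < Real.Gamma ((((d - 1 + 1 : ℕ) : ℝ) + 1) / 2) :=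
      Real.Gamma_pos_of_pos (by positivity)
    rw [integral_uniformSphere]
    simp only [CharP.cast_eq_zero, zero_mul, mul_eq_zero, OfNat.ofNat_ne_zero, false_or] at h
    rcases h with h | h
    · rw [h, mul_zero]
    · rcases h with h | h
      · norm_num at h
      · exact absurd h hpos.ne'
  · intro x r hr
    have hx : ‖(x : EuclideanSpace ℝ (Fin d))‖ = 1 := by simp
    rw [inner_smul_right, norm_smul, hx, mul_one, Real.norm_of_nonneg hr.le]
    ring

theorem abs_inner_sphere_le {d : ℕ} (S : EuclideanSpace ℝ (Fin d)) (c : DiscourseSphere d) :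
    |⟪S, (c : EuclideanSpace ℝ (Fin d))⟫| ≤ ‖S‖ := by
  have h := abs_real_inner_le_norm S (c : EuclideanSpace ℝ (Fin d))
  have hc : ‖(c : EuclideanSpace ℝ (Fin d))‖ = 1 := by simp
  rwa [hc, mul_one] at h

theorem Continuous.integrable_uniformSphere {d : ℕ} (hd : 0 < d) {f : DiscourseSphere d → ℝ}
    (hf : Continuous f) : Integrable f (uniformSphere d) := by
  have := isProbabilityMeasure_uniformSphere hd
  exact hf.integrable_of_hasCompactSupport (HasCompactSupport.of_compactSpace _)

/-- The moment series of the exponential integral over the sphere. -/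
theorem hasSum_moments_uniformSphere {d : ℕ} (hd : 0 < d) (S : EuclideanSpace ℝ (Fin d)) :
    HasSum (fun n : ℕ => (∫ c, ⟪S, (c : EuclideanSpace ℝ (Fin d))⟫ ^ n ∂uniformSphere d) /
        n.factorial)
      (∫ c, Real.exp ⟪S, (c : EuclideanSpace ℝ (Fin d))⟫ ∂uniformSphere d) := by
  have := isProbabilityMeasure_uniformSphere hd
  simp only [← integral_div]
  refine hasSum_integral_of_dominated_convergence (fun n _ => ‖S‖ ^ n / n.factorial)
    (fun n => by fun_prop) (fun n => ae_of_all _ fun c => ?_)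
    (ae_of_all _ fun c => Real.summable_pow_div_factorial _) (integrable_const _)
    (ae_of_all _ fun c => ?_)
  · rw [norm_div, norm_pow, Real.norm_eq_abs, Real.norm_natCast]
    gcongr
    exact abs_inner_sphere_le S c
  · rw [Real.exp_eq_exp_ℝ]
    exact NormedSpace.expSeries_div_hasSum_exp _

theorem integral_inner_pow_odd_uniformSphere {d : ℕ} (hd : 0 < d)
    (S : EuclideanSpace ℝ (Fin d)) (j : ℕ) :
    ∫ c, ⟪S, (c : EuclideanSpace ℝ (Fin d))⟫ ^ (2 * j + 1) ∂uniformSphere d = 0 := by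
  induction j with
  | zero => simpa using integral_inner_uniformSphere hd S
  | succ j ih =>
    have h := integral_inner_pow_uniformSphere_succ hd S (2 * j + 1)
    rw [ih, mul_zero] at h
    have hd' : (0 : ℝ) < d := by exact_mod_cast hd
    exact (mul_eq_zero.1 h).resolve_left (by positivity)

/-- The even moment terms of the exponential integral over the sphere. -/
noncomputable def evenMomentTerm {d : ℕ} (S : EuclideanSpace ℝ (Fin d)) (j : ℕ) : ℝ :=
  (∫ c, ⟪S, (c : EuclideanSpace ℝ (Fin d))⟫ ^ (2 * j) ∂uniformSphere d) / (2 * j).factorial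

theorem hasSum_evenMomentTerm {d : ℕ} (hd : 0 < d) (S : EuclideanSpace ℝ (Fin d)) :
    HasSum (evenMomentTerm S)
      (∫ c, Real.exp ⟪S, (c : EuclideanSpace ℝ (Fin d))⟫ ∂uniformSphere d) := by
  refine ((show Function.Injective (fun j : ℕ => 2 * j) from fun a b h => by
    simpa using h).hasSum_iff ?_).2 (hasSum_moments_uniformSphere hd S)
  intro n hn
  obtain ⟨j, hj | hj⟩ := Nat.even_or_odd' n
  · exact absurd ⟨j, hj.symm⟩ hn
  · rw [hj, integral_inner_pow_odd_uniformSphere hd, zero_div]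

theorem evenMomentTerm_zero {d : ℕ} (hd : 0 < d) (S : EuclideanSpace ℝ (Fin d)) :
    evenMomentTerm S 0 = 1 := by
  have := isProbabilityMeasure_uniformSphere hd
  simp [evenMomentTerm]

/-- Without the factor `1 + 2j/d` this is the recursion of the terms `l ^ j / j!` of the exponential
series, `l = ‖S‖² / (2d)`. -/
theorem evenMomentTerm_succ {d : ℕ} (hd : 0 < d) (S : EuclideanSpace ℝ (Fin d)) (j : ℕ) :
    (1 + 2 * j / d : ℝ) * ((j + 1) * evenMomentTerm S (j + 1)) =
      ‖S‖ ^ 2 / (2 * d) * evenMomentTerm S j := by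
  have h := integral_inner_pow_uniformSphere_succ hd S (2 * j)
  have hd' : (0 : ℝ) < d := by exact_mod_cast hd
  have hf : (0 : ℝ) < (2 * j).factorial := by positivity
  rw [evenMomentTerm, evenMomentTerm, show 2 * (j + 1) = 2 * j + 1 + 1 by ring,
    Nat.factorial_succ, Nat.factorial_succ]
  push_cast at h ⊢
  field_simp
  rw [show 2 * j + 1 + 1 = 2 * j + 2 by ring]
  linear_combination (2 : ℝ) * (j + 1) * h

theorem evenMomentTerm_nonneg {d : ℕ} (S : EuclideanSpace ℝ (Fin d)) (j : ℕ) :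
    0 ≤ evenMomentTerm S j := by
  refine div_nonneg (integral_nonneg fun c => ?_) (Nat.cast_nonneg _)
  exact (even_two_mul j).pow_nonneg _

theorem evenMomentTerm_le {d : ℕ} (hd : 0 < d) (S : EuclideanSpace ℝ (Fin d)) (j : ℕ) :
    evenMomentTerm S j ≤ (‖S‖ ^ 2 / (2 * d)) ^ j / j.factorial := by
  induction j with
  | zero => simp [evenMomentTerm_zero hd]
  | succ j ih =>
    have h := evenMomentTerm_succ hd S j
    have h0 := evenMomentTerm_nonneg S (j + 1)
    set l := ‖S‖ ^ 2 / (2 * d : ℝ)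
    have hl : 0 ≤ l := by positivity
    rw [Nat.factorial_succ, pow_succ, le_div_iff₀ (by positivity)]
    rw [le_div_iff₀ (by positivity)] at ih
    push_cast
    have h1 : ((j : ℝ) + 1) * evenMomentTerm S (j + 1) ≤ l * evenMomentTerm S j := by
      rw [← h]
      refine le_mul_of_one_le_left (by positivity) ?_
      have : (0 : ℝ) ≤ 2 * j / d := by positivity
      linarith
    calc evenMomentTerm S (j + 1) * ((j + 1) * j.factorial)
        = ((j + 1) * evenMomentTerm S (j + 1)) * j.factorial := by ring
      _ ≤ (l * evenMomentTerm S j) * j.factorial := by gcongr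
      _ = (evenMomentTerm S j * j.factorial) * l := by ring
      _ ≤ l ^ j * l := by gcongr

/-- The accumulated defect is the product of `1 / (1 + 2i/d)` over `i < j`, which is at least `1`
minus the sum of the `2i/d`, that is `1 - j (j - 1) / d`. -/
theorem le_evenMomentTerm {d : ℕ} (hd : 0 < d) (S : EuclideanSpace ℝ (Fin d)) (j : ℕ) :
    (‖S‖ ^ 2 / (2 * d)) ^ j / j.factorial * (1 - j * (j - 1) / d) ≤ evenMomentTerm S j := by
  induction j with
  | zero => simp [evenMomentTerm_zero hd]
  | succ j ih =>
    have h := evenMomentTerm_succ hd S j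
    have h0 := evenMomentTerm_nonneg S (j + 1)
    have hd' : (0 : ℝ) < d := by exact_mod_cast hd
    set l := ‖S‖ ^ 2 / (2 * d : ℝ)
    have hl : 0 ≤ l := by positivity
    rcases le_or_gt (1 - ((j + 1 : ℕ) : ℝ) * (((j + 1 : ℕ) : ℝ) - 1) / d) 0 with hneg | hpos
    · exact (mul_nonpos_of_nonneg_of_nonpos (by positivity) hneg).trans h0
    · set x : ℝ := 2 * j / d with hx
      have hx0 : 0 ≤ x := by positivity
      have hj : (0 : ℝ) ≤ j * (j - 1) / d := by
        rcases Nat.eq_zero_or_pos j with rfl | hj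
        · simp
        · have : (1 : ℝ) ≤ j := by exact_mod_cast hj
          have : (0 : ℝ) ≤ j - 1 := by linarith
          positivity
      have e : ((j + 1 : ℕ) : ℝ) * (((j + 1 : ℕ) : ℝ) - 1) / d = j * (j - 1) / d + x := by
        rw [hx]; push_cast; field_simp; ring
      rw [e] at hpos ⊢
      set y : ℝ := j * (j - 1) / d
      -- The left side equals `1 - y - x (y + x)`.
      have h2 : (1 + x) * (1 - (y + x)) ≤ 1 - y := by nlinarith
      have h3 : (1 + x) * ((j + 1) * (l ^ (j + 1) / (j + 1).factorial * (1 - (y + x)))) ≤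
          (1 + x) * ((j + 1) * evenMomentTerm S (j + 1)) := by
        rw [h, Nat.factorial_succ, pow_succ]
        push_cast
        calc (1 + x) * ((j + 1) * (l ^ j * l / ((j + 1) * j.factorial) * (1 - (y + x))))
            = l * (l ^ j / j.factorial * ((1 + x) * (1 - (y + x)))) := by
              field_simp
          _ ≤ l * (l ^ j / j.factorial * (1 - y)) := by gcongr
          _ ≤ l * evenMomentTerm S j := by gcongr
      have h4 := le_of_mul_le_mul_left h3 (by positivity)
      exact le_of_mul_le_mul_left h4 (by positivity)

theorem integral_exp_inner_uniformSphere_le {d : ℕ} (hd : 0 < d)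
    (S : EuclideanSpace ℝ (Fin d)) :
    ∫ c, Real.exp ⟪S, (c : EuclideanSpace ℝ (Fin d))⟫ ∂uniformSphere d ≤
      Real.exp (‖S‖ ^ 2 / (2 * d)) := by
  refine hasSum_le (evenMomentTerm_le hd S) (hasSum_evenMomentTerm hd S) ?_
  rw [Real.exp_eq_exp_ℝ]
  exact NormedSpace.expSeries_div_hasSum_exp _

/-- All even terms are nonnegative and the zeroth is `1`. This lower bound later turns additive
errors into relative ones. -/
theorem one_le_integral_exp_inner_uniformSphere {d : ℕ} (hd : 0 < d)
    (S : EuclideanSpace ℝ (Fin d)) :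
    1 ≤ ∫ c, Real.exp ⟪S, (c : EuclideanSpace ℝ (Fin d))⟫ ∂uniformSphere d := by
  refine (evenMomentTerm_zero hd S).symm.le.trans ?_
  exact le_hasSum (hasSum_evenMomentTerm hd S) 0 fun j _ => evenMomentTerm_nonneg S j

/-- The second factorial moment series of the Poisson weights. -/
theorem hasSum_poisson_factorial_moment (l : ℝ) :
    HasSum (fun j : ℕ => l ^ j / j.factorial * (j * (j - 1))) (l ^ 2 * Real.exp l) := by
  rw [← hasSum_nat_add_iff' 2]
  have h : HasSum (fun j : ℕ => l ^ j / j.factorial) (Real.exp l) := by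
    rw [Real.exp_eq_exp_ℝ]
    exact NormedSpace.expSeries_div_hasSum_exp _
  have e : (fun j : ℕ => l ^ (j + 2) / (j + 2).factorial *
      (((j + 2 : ℕ) : ℝ) * (((j + 2 : ℕ) : ℝ) - 1))) =
      fun j : ℕ => l ^ 2 * (l ^ j / j.factorial) := by
    ext j
    rw [Nat.factorial_succ, Nat.factorial_succ]
    push_cast
    field_simp
    ring
  rw [e]
  simpa [Finset.sum_range_succ] using h.mul_left (l ^ 2)

/-- Summing the termwise bounds, the total defect is `1/d` times the second factorial moment series.
-/
theorem le_integral_exp_inner_uniformSphere {d : ℕ} (hd : 0 < d)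
    (S : EuclideanSpace ℝ (Fin d)) :
    Real.exp (‖S‖ ^ 2 / (2 * d)) * (1 - (‖S‖ ^ 2 / (2 * d)) ^ 2 / d) ≤
      ∫ c, Real.exp ⟪S, (c : EuclideanSpace ℝ (Fin d))⟫ ∂uniformSphere d := by
  refine hasSum_le (le_evenMomentTerm hd S) ?_ (hasSum_evenMomentTerm hd S)
  set l := ‖S‖ ^ 2 / (2 * d : ℝ)
  have h : HasSum (fun j : ℕ => l ^ j / j.factorial) (Real.exp l) := by
    rw [Real.exp_eq_exp_ℝ]
    exact NormedSpace.expSeries_div_hasSum_exp _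
  have e : (fun j : ℕ => l ^ j / j.factorial * (1 - j * (j - 1) / d : ℝ)) =
      fun j : ℕ => l ^ j / j.factorial - l ^ j / j.factorial * (j * (j - 1)) / d := by
    ext j
    ring
  rw [e, mul_sub, mul_one, ← mul_div_assoc, mul_comm (Real.exp l) (l ^ 2)]
  exact h.sub ((hasSum_poisson_factorial_moment l).div_const (d : ℝ))

/-! ### Emission probabilities and the law of the text -/

section Emission

variable {d : ℕ} {V : Type*} [Fintype V] (v : V → EuclideanSpace ℝ (Fin d))

theorem exp_le_partitionFn (c : DiscourseSphere d) (w : V) :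
    Real.exp ⟪v w, (c : EuclideanSpace ℝ (Fin d))⟫ ≤ partitionFn v c :=
  Finset.single_le_sum (f := fun w => Real.exp ⟪v w, (c : EuclideanSpace ℝ (Fin d))⟫)
    (fun _ _ => (Real.exp_pos _).le) (Finset.mem_univ w)

theorem partitionFn_pos (c : DiscourseSphere d) (w : V) : 0 < partitionFn v c :=
  (Real.exp_pos _).trans_le (exp_le_partitionFn v c w)

theorem continuous_partitionFn : Continuous (partitionFn v) := by
  unfold partitionFn
  fun_prop

theorem emissionProb_pos (c : DiscourseSphere d) (w : V) : 0 < emissionProb v c w :=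
  div_pos (Real.exp_pos _) (partitionFn_pos v c w)

theorem emissionProb_le_one (c : DiscourseSphere d) (w : V) : emissionProb v c w ≤ 1 :=
  (div_le_one (partitionFn_pos v c w)).2 (exp_le_partitionFn v c w)

theorem continuous_emissionProb (w : V) : Continuous fun c => emissionProb v c w := by
  unfold emissionProb
  exact Continuous.div (by fun_prop) (continuous_partitionFn v)
    fun c => (partitionFn_pos v c w).ne'

end Emission

namespace IsRandomWalkModel

variable {d : ℕ} {V Ω : Type*} [Fintype V] [MeasurableSpace V]
    [MeasurableSpace Ω]
    {v : V → EuclideanSpace ℝ (Fin d)} {ε₂ : ℝ}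
    {P : Kernel (DiscourseSphere d) (DiscourseSphere d)} {μ : Measure Ω}
    {c : ℕ → Ω → DiscourseSphere d} {W : ℕ → Ω → V}

/-- The discourse vector is uniformly distributed at every time. -/
theorem map_walk [IsProbabilityMeasure μ] [IsMarkovKernel P]
    (h : IsRandomWalkModel v ε₂ P μ c W) (t : ℕ) : μ.map (c t) = uniformSphere d := by
  induction t with
  | zero => exact h.law_zero
  | succ t ih =>
    have hp : IsProbabilityMeasure (uniformSphere d) := by
      rw [← ih]; exact Measure.isProbabilityMeasure_map (h.measurable_walk t).aemeasurable
    have hm : walkPast c t ≤ ‹MeasurableSpace Ω› :=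
      iSup_le fun s => iSup_le fun _ => (h.measurable_walk s).comap_le
    have hq := Measure.isProbabilityMeasure_map (μ := μ) (h.measurable_walk (t + 1)).aemeasurable
    ext B hB
    rw [← ENNReal.toReal_eq_toReal_iff' (measure_ne_top _ _) (measure_ne_top _ _)]
    have hBm := h.measurable_walk (t + 1) hB
    calc ((μ.map (c (t + 1))) B).toReal = μ.real (c (t + 1) ⁻¹' B) := by
          rw [Measure.map_apply (h.measurable_walk _) hB, Measure.real]
      _ = ∫ ω, (μ⟦c (t + 1) ⁻¹' B | walkPast c t⟧) ω ∂μ := by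
          rw [integral_condExp hm, integral_indicator_const _ hBm, smul_eq_mul, mul_one]
      _ = ∫ ω, (P (c t ω)).real B ∂μ := integral_congr_ae (h.markov t B hB)
      _ = ∫ x, (P x).real B ∂(uniformSphere d) := by
          rw [← ih, integral_map (h.measurable_walk t).aemeasurable]
          exact ((P.measurable_coe hB).ennreal_toReal).aestronglyMeasurable
      _ = (uniformSphere d B).toReal := by
          conv_rhs => rw [← h.stationary.def, Measure.bind_apply hB P.aemeasurable]
          simp only [Measure.real]
          exact integral_toReal (P.measurable_coe hB).aemeasurable
            (ae_of_all _ fun x => measure_lt_top _ _)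

/-- Integrals of functions of the walk over the event of emitting given words. -/
theorem setIntegral_words [MeasurableSingletonClass V] [IsProbabilityMeasure μ]
    (h : IsRandomWalkModel v ε₂ P μ c W) (s : ℕ) {k : ℕ} (u : Fin k → V) (X : Ω → ℝ) (K : ℝ)
    (hX : Measurable[⨆ s, MeasurableSpace.comap (c s) inferInstance] X) (hK : ∀ ω, |X ω| ≤ K) :
    ∫ ω in {ω | ∀ i : Fin k, W (s + i) ω = u i}, X ω ∂μ =
      ∫ ω, X ω * ∏ i : Fin k, emissionProb v (c (s + i) ω) (u i) ∂μ := by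
  -- The last word is peeled off by conditioning on the walk and the earlier words. Its emission
  -- probability depends on the walk alone and is at most `1`, so it can be absorbed into `X` with
  -- the same bound `K`; hence the generalization over `X`.
  induction k generalizing X K with
  | zero => simp
  | succ k ih =>
    set A : Set Ω := {ω | ∀ i : Fin k, W (s + i) ω = u i.castSucc}
    set w := u (Fin.last k)
    have hc : (⨆ s, MeasurableSpace.comap (c s) inferInstance) ≤
        walkAndWordsBefore c W (s + k) := le_sup_left
    have hm : walkAndWordsBefore c W (s + k) ≤ ‹MeasurableSpace Ω› :=
      sup_le (iSup_le fun s => (h.measurable_walk s).comap_le)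
        (iSup_le fun s => iSup_le fun _ => (h.measurable_word s).comap_le)
    have hB : MeasurableSet (W (s + k) ⁻¹' {w}) := h.measurable_word _ (measurableSet_singleton w)
    have hA : MeasurableSet[walkAndWordsBefore c W (s + k)] A := by
      have : A = ⋂ i : Fin k, W (s + i) ⁻¹' {u i.castSucc} := by
        ext ω; simp [A]
      rw [this]
      refine MeasurableSet.iInter fun i => ?_
      have hle : MeasurableSpace.comap (W (s + i)) inferInstance ≤ walkAndWordsBefore c W (s + k) :=
        (le_iSup₂_of_le (f := fun t (_ : t < s + k) => MeasurableSpace.comap (W t) inferInstance)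
          (s + i) (by omega) le_rfl).trans le_sup_right
      exact hle _ ⟨_, measurableSet_singleton _, rfl⟩
    have hAB : {ω | ∀ i : Fin (k + 1), W (s + i) ω = u i} = A ∩ W (s + k) ⁻¹' {w} := by
      ext ω
      simp [A, w, Fin.forall_fin_succ']
    have hAX : Measurable[walkAndWordsBefore c W (s + k)] (A.indicator X) :=
      (hX.mono hc le_rfl).indicator hA
    have hAX' : Measurable (A.indicator X) := hAX.mono hm le_rfl
    have hAXK : ∀ ω, ‖A.indicator X ω‖ ≤ K := fun ω =>
      (norm_indicator_le_norm_self X ω).trans (hK ω)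
    have hint : Integrable ((W (s + k) ⁻¹' {w}).indicator fun _ => (1 : ℝ)) μ :=
      (integrable_const _).indicator hB
    have hpull := condExp_mul_of_stronglyMeasurable_left (μ := μ) hAX.stronglyMeasurable
      (hint.bdd_mul hAX'.aestronglyMeasurable (ae_of_all _ hAXK)) hint
    have hemis : Measurable[⨆ s, MeasurableSpace.comap (c s) inferInstance]
        fun ω => emissionProb v (c (s + k) ω) w :=
      (continuous_emissionProb v w).measurable.comp
        ((comap_measurable (c (s + k))).mono
          (le_iSup (fun s => MeasurableSpace.comap (c s) inferInstance) (s + k)) le_rfl)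
    calc ∫ ω in {ω | ∀ i : Fin (k + 1), W (s + i) ω = u i}, X ω ∂μ
        = ∫ ω, (A.indicator X * (W (s + k) ⁻¹' {w}).indicator fun _ => (1 : ℝ)) ω ∂μ := by
          rw [hAB, ← integral_indicator ((hm _ hA).inter hB)]
          congr 1
          ext ω
          by_cases h1 : ω ∈ A <;> by_cases h2 : ω ∈ W (s + k) ⁻¹' {w} <;>
            simp [h1, h2, Set.indicator]
      _ = ∫ ω, (μ[A.indicator X * (W (s + k) ⁻¹' {w}).indicator fun _ => (1 : ℝ) |
            walkAndWordsBefore c W (s + k)]) ω ∂μ :=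
          (integral_condExp hm).symm
      _ = ∫ ω, A.indicator X ω * emissionProb v (c (s + k) ω) w ∂μ := by
          refine integral_congr_ae ?_
          filter_upwards [hpull, h.emission (s + k) w] with ω h1 h2
          rw [h1, Pi.mul_apply, h2]
      _ = ∫ ω in A, X ω * emissionProb v (c (s + k) ω) w ∂μ := by
          rw [← integral_indicator (hm _ hA)]
          congr 1
          ext ω
          by_cases h1 : ω ∈ A <;> simp [h1]
      _ = ∫ ω, (X ω * emissionProb v (c (s + k) ω) w) *
            ∏ i : Fin k, emissionProb v (c (s + i) ω) (u i.castSucc) ∂μ := by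
          refine ih (fun i => u i.castSucc) _ K (hX.mul hemis) fun ω => ?_
          rw [abs_mul, abs_of_pos (emissionProb_pos v _ w)]
          exact (mul_le_of_le_one_right (abs_nonneg _) (emissionProb_le_one v _ w)).trans (hK ω)
      _ = _ := by
          congr 1
          ext ω
          rw [Fin.prod_univ_castSucc]
          simp only [Fin.val_castSucc, Fin.val_last, w]
          ring

/-- The joint probability of consecutive words as an expectation over the walk. -/
theorem jointProb_eq [MeasurableSingletonClass V] [IsProbabilityMeasure μ]
    (h : IsRandomWalkModel v ε₂ P μ c W) (s : ℕ) {k : ℕ} (u : Fin k → V) :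
    jointProb μ W s u = ∫ ω, ∏ i : Fin k, emissionProb v (c (s + i) ω) (u i) ∂μ := by
  have := h.setIntegral_words s u (fun _ => 1) 1 measurable_const (by simp)
  simpa [jointProb] using this

/-- The walk moves by at most `i ε₂ / √d` in `i` steps. -/
theorem ae_norm_sub_le (h : IsRandomWalkModel v ε₂ P μ c W) (s i : ℕ) :
    ∀ᵐ ω ∂μ, ‖(c (s + i) ω : EuclideanSpace ℝ (Fin d)) - c s ω‖ ≤ i * (ε₂ / √(d : ℝ)) := by
  induction i with
  | zero => simp
  | succ i ih =>
    filter_upwards [ih, h.slow (s + i)] with ω h1 h2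
    calc ‖(c (s + (i + 1)) ω : EuclideanSpace ℝ (Fin d)) - c s ω‖
        = ‖((c (s + i + 1) ω : EuclideanSpace ℝ (Fin d)) - c (s + i) ω) +
            ((c (s + i) ω : EuclideanSpace ℝ (Fin d)) - c s ω)‖ := by
          rw [sub_add_sub_cancel]; rfl
      _ ≤ ε₂ / √(d : ℝ) + i * (ε₂ / √(d : ℝ)) := (norm_add_le _ _).trans (add_le_add h2 h1)
      _ = _ := by push_cast; ring

end IsRandomWalkModel

/-! ### Comparison with a single discourse vector, and the size of `Z` -/

section PointwiseBounds

variable {d : ℕ} {V : Type*} [Fintype V] {v : V → EuclideanSpace ℝ (Fin d)}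

theorem prod_emissionProb_le {k : ℕ} {u : Fin k → V} {x : Fin k → DiscourseSphere d}
    {y : DiscourseSphere d} {D z : ℝ} (hz : 0 < z)
    (hx : ∀ i, ⟪v (u i), (x i : EuclideanSpace ℝ (Fin d))⟫ ≤
      ⟪v (u i), (y : EuclideanSpace ℝ (Fin d))⟫ + D)
    (hZ : ∀ i, z ≤ partitionFn v (x i)) :
    ∏ i, emissionProb v (x i) (u i) ≤
      Real.exp (k * D) / z ^ k * Real.exp ⟪∑ i, v (u i), (y : EuclideanSpace ℝ (Fin d))⟫ := by
  calc ∏ i, emissionProb v (x i) (u i)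
      ≤ ∏ i, (Real.exp (⟪v (u i), (y : EuclideanSpace ℝ (Fin d))⟫ + D) / z) := by
        refine Finset.prod_le_prod (fun i _ => (emissionProb_pos v _ _).le) fun i _ => ?_
        exact div_le_div₀ (Real.exp_pos _).le (Real.exp_le_exp.2 (hx i)) hz (hZ i)
    _ = _ := by
        rw [Finset.prod_div_distrib, ← Real.exp_sum, Finset.sum_add_distrib, sum_inner,
          Real.exp_add]
        simp
        ring

theorem le_prod_emissionProb {k : ℕ} {u : Fin k → V} {x : Fin k → DiscourseSphere d}
    {y : DiscourseSphere d} {D z : ℝ}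
    (hx : ∀ i, ⟪v (u i), (y : EuclideanSpace ℝ (Fin d))⟫ - D ≤
      ⟪v (u i), (x i : EuclideanSpace ℝ (Fin d))⟫)
    (hz : 0 < z) (hZ : ∀ i, partitionFn v (x i) ≤ z) :
    Real.exp (-(k * D)) / z ^ k * Real.exp ⟪∑ i, v (u i), (y : EuclideanSpace ℝ (Fin d))⟫ ≤
      ∏ i, emissionProb v (x i) (u i) := by
  calc _ = ∏ i, (Real.exp (⟪v (u i), (y : EuclideanSpace ℝ (Fin d))⟫ - D) / z) := by
        rw [Finset.prod_div_distrib, ← Real.exp_sum, Finset.sum_sub_distrib, sum_inner,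
          sub_eq_add_neg, Real.exp_add]
        simp
        ring
    _ ≤ _ := by
        refine Finset.prod_le_prod (fun i _ => by positivity) fun i _ => ?_
        exact div_le_div₀ (Real.exp_pos _).le (Real.exp_le_exp.2 (hx i))
          (partitionFn_pos v _ (u i)) (hZ i)

end PointwiseBounds

/-- A weighted arithmetic–geometric mean inequality, serving as a pointwise substitute for
Cauchy–Schwarz on the exceptional event. -/
theorem le_sq_add_inv {t x : ℝ} (ht : 0 < t) : x ≤ t / 2 * x ^ 2 + 1 / (2 * t) := by
  have h : t / 2 * x ^ 2 + 1 / (2 * t) - x = (t * x - 1) ^ 2 / (2 * t) := by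
    field_simp
    ring
  have : 0 ≤ (t * x - 1) ^ 2 / (2 * t) := by positivity
  linarith

/-- A constant around which the partition function concentrates is at most of the order of the
size of the vocabulary. -/
theorem PartitionConcentrates.mul_le {d : ℕ} (hd : 0 < d) {V : Type*} [Fintype V]
    {v : V → EuclideanSpace ℝ (Fin d)} {κ Z εz δ : ℝ}
    (hv : ∀ w, ‖v w‖ ≤ κ * √(d : ℝ)) (hZ : 0 < Z) (hεz : εz ≤ 1 / 2)
    (h : PartitionConcentrates v Z εz δ) :
    (1 - δ) * ((1 - εz) * Z) ≤ Fintype.card V * Real.exp (κ ^ 2 / 2) := by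
  have := isProbabilityMeasure_uniformSphere hd
  have hd' : (0 : ℝ) < d := by exact_mod_cast hd
  have hz : 0 < (1 - εz) * Z := mul_pos (by linarith) hZ
  have hnn : ∀ c, 0 ≤ partitionFn v c := fun c =>
    Finset.sum_nonneg fun w _ => (Real.exp_pos _).le
  have hi := (continuous_partitionFn v).integrable_uniformSphere hd
  -- Markov's inequality bounds the product by the mean of the partition function, in which each
  -- word contributes at most `exp (κ² / 2)`.
  calc (1 - δ) * ((1 - εz) * Z)
      ≤ (uniformSphere d).real {c | (1 - εz) * Z ≤ partitionFn v c} * ((1 - εz) * Z) := by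
        gcongr
        exact le_trans h (measureReal_mono fun c hc => hc.1)
    _ ≤ ∫ c, partitionFn v c ∂uniformSphere d := by
        rw [mul_comm]
        exact mul_meas_ge_le_integral_of_nonneg (ae_of_all _ hnn) hi _
    _ = ∑ w, ∫ c, Real.exp ⟪v w, (c : EuclideanSpace ℝ (Fin d))⟫ ∂uniformSphere d := by
        unfold partitionFn
        exact integral_finsetSum _ fun w _ =>
          Continuous.integrable_uniformSphere hd (by fun_prop)
    _ ≤ ∑ w : V, Real.exp (κ ^ 2 / 2) := by
        refine Finset.sum_le_sum fun w _ => (integral_exp_inner_uniformSphere_le hd _).trans ?_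
        refine Real.exp_le_exp.2 ?_
        rw [div_le_div_iff₀ (by positivity) two_pos]
        have h1 : ‖v w‖ ^ 2 ≤ (κ * √(d : ℝ)) ^ 2 := by
          gcongr
          exact hv w
        rw [mul_pow, Real.sq_sqrt hd'.le] at h1
        linarith
    _ = _ := by simp

/-! ### The good event and two-sided bounds for the joint probability -/

section GoodEvent

variable {d : ℕ} {V Ω : Type*} [Fintype V] {v : V → EuclideanSpace ℝ (Fin d)}
    {c : ℕ → Ω → DiscourseSphere d}

/-- The event that the partition function is close to `Z` at `k` consecutive times. -/
def goodEvent (v : V → EuclideanSpace ℝ (Fin d)) (c : ℕ → Ω → DiscourseSphere d) (Z εz : ℝ)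
    (s k : ℕ) : Set Ω :=
  {ω | ∀ i : Fin k, (1 - εz) * Z ≤ partitionFn v (c (s + i) ω) ∧
    partitionFn v (c (s + i) ω) ≤ (1 + εz) * Z}

theorem goodEvent_eq (Z εz : ℝ) (s k : ℕ) :
    goodEvent v c Z εz s k = ⋂ i : Fin k, c (s + i) ⁻¹'
      {x | (1 - εz) * Z ≤ partitionFn v x ∧ partitionFn v x ≤ (1 + εz) * Z} := by
  ext ω
  simp [goodEvent]

theorem measurableSet_partitionFn_mem (Z εz : ℝ) : MeasurableSet
    {x | (1 - εz) * Z ≤ partitionFn v x ∧ partitionFn v x ≤ (1 + εz) * Z} :=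
  (measurableSet_le measurable_const (continuous_partitionFn v).measurable).inter
    (measurableSet_le (continuous_partitionFn v).measurable measurable_const)

end GoodEvent

namespace IsRandomWalkModel

variable {d : ℕ} {V Ω : Type*} [Fintype V] [MeasurableSpace V] [MeasurableSpace Ω]
    {v : V → EuclideanSpace ℝ (Fin d)} {ε₂ : ℝ}
    {P : Kernel (DiscourseSphere d) (DiscourseSphere d)} {μ : Measure Ω}
    {c : ℕ → Ω → DiscourseSphere d} {W : ℕ → Ω → V}

theorem measurableSet_goodEvent (h : IsRandomWalkModel v ε₂ P μ c W) (Z εz : ℝ) (s k : ℕ) :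
    MeasurableSet (goodEvent v c Z εz s k) := by
  rw [goodEvent_eq]
  exact MeasurableSet.iInter fun i => h.measurable_walk _ (measurableSet_partitionFn_mem Z εz)

/-- Union bound over the `k` times, at each of which the discourse vector is uniform. -/
theorem measureReal_goodEvent_compl_le [IsProbabilityMeasure μ] [IsMarkovKernel P] (hd : 0 < d)
    (h : IsRandomWalkModel v ε₂ P μ c W) {Z εz δ : ℝ} (hconc : PartitionConcentrates v Z εz δ)
    (s k : ℕ) : μ.real (goodEvent v c Z εz s k)ᶜ ≤ k * δ := by
  have := isProbabilityMeasure_uniformSphere hd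
  have hB := measurableSet_partitionFn_mem (v := v) Z εz
  rw [goodEvent_eq, Set.compl_iInter]
  refine (measureReal_iUnion_fintype_le _).trans ?_
  calc _ ≤ ∑ i : Fin k, δ := by
        refine Finset.sum_le_sum fun i _ => ?_
        rw [← Set.preimage_compl, ← map_measureReal_apply (h.measurable_walk _) hB.compl,
          h.map_walk, probReal_compl_eq_one_sub hB]
        unfold PartitionConcentrates at hconc
        linarith
    _ = _ := by simp

theorem integral_comp_walk [IsProbabilityMeasure μ] [IsMarkovKernel P]
    (h : IsRandomWalkModel v ε₂ P μ c W) (s : ℕ) {f : DiscourseSphere d → ℝ}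
    (hf : Continuous f) : ∫ ω, f (c s ω) ∂μ = ∫ x, f x ∂uniformSphere d := by
  rw [← h.map_walk s, integral_map (h.measurable_walk s).aemeasurable
    hf.measurable.aestronglyMeasurable]

theorem integrable_comp_walk [IsProbabilityMeasure μ] [IsMarkovKernel P] (hd : 0 < d)
    (h : IsRandomWalkModel v ε₂ P μ c W) (s : ℕ) {f : DiscourseSphere d → ℝ}
    (hf : Continuous f) : Integrable (fun ω => f (c s ω)) μ := by
  have := hf.integrable_uniformSphere hd
  rw [← h.map_walk s] at this
  exact this.comp_measurable (h.measurable_walk s)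

theorem integrable_prod_emissionProb [IsProbabilityMeasure μ]
    (h : IsRandomWalkModel v ε₂ P μ c W) (s : ℕ) {k : ℕ} (u : Fin k → V) :
    Integrable (fun ω => ∏ i : Fin k, emissionProb v (c (s + i) ω) (u i)) μ := by
  refine Integrable.of_bound (C := 1) ?_ (ae_of_all _ fun ω => ?_)
  · exact (Finset.measurable_prod _ fun i _ =>
      (continuous_emissionProb v (u i)).measurable.comp
        (h.measurable_walk _)).aestronglyMeasurable
  · rw [Real.norm_of_nonneg (Finset.prod_nonneg fun i _ => (emissionProb_pos v _ _).le)]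
    exact Finset.prod_le_one (fun i _ => (emissionProb_pos v _ _).le)
      fun i _ => emissionProb_le_one v _ _

/-- Over `k` steps of the walk, the logits of the words change by at most `κ k ε₂`. -/
theorem ae_abs_inner_sub_le (hd : 0 < d) (h : IsRandomWalkModel v ε₂ P μ c W) {κ : ℝ}
    (hε₂ : 0 ≤ ε₂) (hv : ∀ w, ‖v w‖ ≤ κ * √(d : ℝ)) (s k : ℕ) :
    ∀ᵐ ω ∂μ, ∀ (i : Fin k) (w : V), |⟪v w, (c (s + i) ω : EuclideanSpace ℝ (Fin d))⟫ -
      ⟪v w, (c s ω : EuclideanSpace ℝ (Fin d))⟫| ≤ κ * k * ε₂ := by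
  have hd' : (0 : ℝ) < d := by exact_mod_cast hd
  rw [ae_all_iff]
  intro i
  filter_upwards [h.ae_norm_sub_le s i] with ω hω w
  have hik : ((i : ℕ) : ℝ) ≤ k := by exact_mod_cast i.2.le
  rw [← inner_sub_right]
  calc _ ≤ ‖v w‖ * ‖(c (s + i) ω : EuclideanSpace ℝ (Fin d)) - c s ω‖ :=
        abs_real_inner_le_norm _ _
    _ ≤ (κ * √(d : ℝ)) * (k * (ε₂ / √(d : ℝ))) := by
        refine mul_le_mul (hv w) (hω.trans ?_) (norm_nonneg _) ((norm_nonneg _).trans (hv w))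
        gcongr
    _ = κ * k * ε₂ := by
        have : √(d : ℝ) ≠ 0 := (Real.sqrt_pos.2 hd').ne'
        field_simp

/-- Off the good event the product is only bounded by `1`, whence the additive `k δ`. -/
theorem jointProb_le [MeasurableSingletonClass V] [IsProbabilityMeasure μ]
    [IsMarkovKernel P] (hd : 0 < d)
    (h : IsRandomWalkModel v ε₂ P μ c W) {κ Z εz δ : ℝ} (hε₂ : 0 ≤ ε₂)
    (hv : ∀ w, ‖v w‖ ≤ κ * √(d : ℝ)) (hZ : 0 < Z) (hεz : εz ≤ 1 / 2)
    (hconc : PartitionConcentrates v Z εz δ) (s : ℕ) {k : ℕ} (u : Fin k → V) :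
    jointProb μ W s u ≤ Real.exp (k * (κ * k * ε₂)) / ((1 - εz) * Z) ^ k *
      (∫ x, Real.exp ⟪∑ i, v (u i), (x : EuclideanSpace ℝ (Fin d))⟫ ∂uniformSphere d) +
        k * δ := by
  set S := ∑ i, v (u i)
  have hz : 0 < (1 - εz) * Z := mul_pos (by linarith) hZ
  set A := Real.exp (k * (κ * k * ε₂)) / ((1 - εz) * Z) ^ k with hA
  have hA0 : 0 < A := by positivity
  set G := goodEvent v c Z εz s k
  have hG : MeasurableSet G := h.measurableSet_goodEvent Z εz s k
  have hf : Continuous fun x : DiscourseSphere d =>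
      A * Real.exp ⟪S, (x : EuclideanSpace ℝ (Fin d))⟫ := by fun_prop
  have hi1 := h.integrable_comp_walk hd s hf
  have hi2 : Integrable (Gᶜ.indicator fun _ : Ω => (1 : ℝ)) μ :=
    (integrable_const _).indicator hG.compl
  rw [h.jointProb_eq]
  calc _ ≤ ∫ ω, (A * Real.exp ⟪S, (c s ω : EuclideanSpace ℝ (Fin d))⟫ +
          Gᶜ.indicator (fun _ : Ω => (1 : ℝ)) ω) ∂μ := by
        refine integral_mono_ae (h.integrable_prod_emissionProb s u) (hi1.add hi2) ?_
        filter_upwards [h.ae_abs_inner_sub_le hd hε₂ hv s k] with ω hω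
        by_cases hg : ω ∈ G
        · simp only [Set.indicator_of_notMem (Set.notMem_compl_iff.2 hg), add_zero]
          exact prod_emissionProb_le hz
            (fun i => by linarith [(abs_le.1 (hω i (u i))).2]) fun i => (hg i).1
        · simp only [Set.indicator_of_mem (Set.mem_compl hg)]
          have h1 : ∏ i : Fin k, emissionProb v (c (s + i) ω) (u i) ≤ 1 :=
            Finset.prod_le_one (fun i _ => (emissionProb_pos v _ _).le)
              fun i _ => emissionProb_le_one v _ _
          have h2 : 0 ≤ A * Real.exp ⟪S, (c s ω : EuclideanSpace ℝ (Fin d))⟫ := by positivity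
          linarith
    _ = A * (∫ x, Real.exp ⟪S, (x : EuclideanSpace ℝ (Fin d))⟫ ∂uniformSphere d) +
          μ.real Gᶜ := by
        rw [integral_add hi1 hi2, h.integral_comp_walk s hf, integral_const_mul,
          integral_indicator_const _ hG.compl, smul_eq_mul, mul_one]
    _ ≤ _ := by
        gcongr
        exact h.measureReal_goodEvent_compl_le hd hconc s k

/-- The failure probability is written `t ^ 2` so that the weight `t` balances the second moment `t
/ 2 * exp (4 l)` against `k t² / (2 t) = k t / 2`. -/
theorem le_jointProb [MeasurableSingletonClass V] [IsProbabilityMeasure μ]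
    [IsMarkovKernel P] (hd : 0 < d)
    (h : IsRandomWalkModel v ε₂ P μ c W) {κ Z εz t : ℝ} (hε₂ : 0 ≤ ε₂)
    (hv : ∀ w, ‖v w‖ ≤ κ * √(d : ℝ)) (hZ : 0 < Z) (hεz : 0 ≤ εz) (ht : 0 < t)
    (hconc : PartitionConcentrates v Z εz (t ^ 2)) (s : ℕ) {k : ℕ} (u : Fin k → V) :
    Real.exp (-(k * (κ * k * ε₂))) / ((1 + εz) * Z) ^ k *
      ((∫ x, Real.exp ⟪∑ i, v (u i), (x : EuclideanSpace ℝ (Fin d))⟫ ∂uniformSphere d) -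
        t / 2 * (Real.exp (4 * (‖∑ i, v (u i)‖ ^ 2 / (2 * d))) + k)) ≤ jointProb μ W s u := by
  set S := ∑ i, v (u i)
  have hz : 0 < (1 + εz) * Z := mul_pos (by linarith) hZ
  set A := Real.exp (-(k * (κ * k * ε₂))) / ((1 + εz) * Z) ^ k with hA
  have hA0 : 0 < A := by positivity
  set G := goodEvent v c Z εz s k
  have hG : MeasurableSet G := h.measurableSet_goodEvent Z εz s k
  -- With `X = exp ⟪S, c s⟫`, the minorant is `A (X - t/2 X²)`, minus `A / (2t)` off the good event.
  -- On the good event dropping the square only helps; off it the minorant is nonpositive by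
  -- `le_sq_add_inv`.
  have hf : Continuous fun x : DiscourseSphere d =>
      A * (Real.exp ⟪S, (x : EuclideanSpace ℝ (Fin d))⟫ -
        t / 2 * Real.exp ⟪(2 : ℝ) • S, (x : EuclideanSpace ℝ (Fin d))⟫) := by fun_prop
  have hi1 := h.integrable_comp_walk hd s hf
  have hi2 : Integrable (Gᶜ.indicator fun _ : Ω => A * (1 / (2 * t))) μ :=
    (integrable_const _).indicator hG.compl
  have hsq : ∀ x : DiscourseSphere d, Real.exp ⟪(2 : ℝ) • S, (x : EuclideanSpace ℝ (Fin d))⟫ =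
      Real.exp ⟪S, (x : EuclideanSpace ℝ (Fin d))⟫ ^ 2 := fun x => by
    rw [real_inner_smul_left, ← Real.exp_nat_mul]
    norm_num
  have hM2 : ∫ x, Real.exp ⟪(2 : ℝ) • S, (x : EuclideanSpace ℝ (Fin d))⟫ ∂uniformSphere d ≤
      Real.exp (4 * (‖S‖ ^ 2 / (2 * d))) := by
    refine (integral_exp_inner_uniformSphere_le hd _).trans_eq ?_
    rw [norm_smul]
    congr 1
    norm_num
    ring
  rw [h.jointProb_eq]
  calc _ ≤ A * ((∫ x, Real.exp ⟪S, (x : EuclideanSpace ℝ (Fin d))⟫ ∂uniformSphere d) -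
        t / 2 * ∫ x, Real.exp ⟪(2 : ℝ) • S, (x : EuclideanSpace ℝ (Fin d))⟫ ∂uniformSphere d) -
        μ.real Gᶜ * (A * (1 / (2 * t))) := by
        have hb := h.measureReal_goodEvent_compl_le hd hconc s k
        have hb' : μ.real Gᶜ * (1 / (2 * t)) ≤ t / 2 * k := by
          calc _ ≤ (k * t ^ 2) * (1 / (2 * t)) := by gcongr
            _ = _ := by field_simp
        have h3 := mul_le_mul_of_nonneg_left hM2 (half_pos ht).le
        have h4 := mul_le_mul_of_nonneg_left (add_le_add hb' h3) hA0.le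
        linear_combination h4
    _ = ∫ ω, (A * (Real.exp ⟪S, (c s ω : EuclideanSpace ℝ (Fin d))⟫ -
        t / 2 * Real.exp ⟪(2 : ℝ) • S, (c s ω : EuclideanSpace ℝ (Fin d))⟫) -
          Gᶜ.indicator (fun _ : Ω => A * (1 / (2 * t))) ω) ∂μ := by
        rw [integral_sub hi1 hi2, h.integral_comp_walk s hf, integral_const_mul,
          integral_indicator_const _ hG.compl, smul_eq_mul, integral_sub, integral_const_mul]
        · exact Continuous.integrable_uniformSphere hd (by fun_prop)
        · exact Continuous.integrable_uniformSphere hd (by fun_prop)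
    _ ≤ _ := by
        refine integral_mono_ae (hi1.sub hi2) (h.integrable_prod_emissionProb s u) ?_
        filter_upwards [h.ae_abs_inner_sub_le hd hε₂ hv s k] with ω hω
        by_cases hg : ω ∈ G
        · simp only [Set.indicator_of_notMem (Set.notMem_compl_iff.2 hg), sub_zero]
          refine le_trans ?_ (le_prod_emissionProb (y := c s ω) (D := κ * k * ε₂)
            (fun i => by linarith [(abs_le.1 (hω i (u i))).1]) hz fun i => (hg i).2)
          gcongr
          have := Real.exp_pos ⟪(2 : ℝ) • S, (c s ω : EuclideanSpace ℝ (Fin d))⟫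
          have := mul_pos (half_pos ht) this
          linarith
        · simp only [Set.indicator_of_mem (Set.mem_compl hg)]
          refine le_trans ?_ (Finset.prod_nonneg fun i _ => (emissionProb_pos v _ _).le)
          rw [hsq, ← mul_sub]
          refine mul_nonpos_of_nonneg_of_nonpos hA0.le ?_
          linarith [le_sq_add_inv (x := Real.exp ⟪S, (c s ω : EuclideanSpace ℝ (Fin d))⟫) ht]

end IsRandomWalkModel

/-! ### Passage to logarithms -/

/-- With `L = log n`: the factor `exp (-a log² n)` beats every fixed power of `n`, with `1 / n` to
spare. -/
theorem exists_forall_mul_exp_neg_sq_le {a : ℝ} (ha : 0 < a) (K b : ℝ) :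
    ∃ L₀ : ℝ, ∀ L, L₀ ≤ L →
      K * Real.exp (b * L) * Real.exp (-a * L ^ 2) ≤ Real.exp (-L) := by
  refine ⟨max 1 ((|K| + |b| + 1) / a), fun L hL => ?_⟩
  have h1 : 1 ≤ L := (le_max_left _ _).trans hL
  have h2 : |K| + |b| + 1 ≤ L * a := (div_le_iff₀ ha).1 ((le_max_right _ _).trans hL)
  have hK : K ≤ Real.exp |K| :=
    (le_abs_self K).trans (by linarith [Real.add_one_le_exp |K|])
  calc K * Real.exp (b * L) * Real.exp (-a * L ^ 2)
      ≤ Real.exp |K| * Real.exp (b * L) * Real.exp (-a * L ^ 2) := by gcongr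
    _ = Real.exp (|K| + b * L + -a * L ^ 2) := by rw [Real.exp_add, Real.exp_add]
    _ ≤ Real.exp (-L) := by
        refine Real.exp_le_exp.2 ?_
        have h3 : (|K| + |b| + 1) * L ≤ L * a * L := by gcongr
        have h4 : |K| ≤ |K| * L := le_mul_of_one_le_right (abs_nonneg _) h1
        have h5 : b * L ≤ |b| * L := by gcongr; exact le_abs_self b
        linarith

theorem neg_two_mul_le_log_one_sub {x : ℝ} (h0 : 0 ≤ x) (h1 : x ≤ 1 / 2) :
    -(2 * x) ≤ Real.log (1 - x) := by
  have h := Real.one_sub_inv_le_log_of_pos (show 0 < 1 - x by linarith)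
  have h2 : (1 - x)⁻¹ ≤ 1 + 2 * x := by
    rw [inv_le_comm₀ (by linarith) (by linarith), inv_le_iff_one_le_mul₀ (by linarith)]
    nlinarith
  linarith

/-- Upper bound for the logarithm of `exp D / ((1 - ε) Z) ^ k * M + r`. -/
theorem log_le_of_le_exp_div_mul_add {k : ℕ} {p D ε Z M r l η : ℝ} (hp : 0 < p) (hD : 0 ≤ D)
    (hε : 0 ≤ ε) (hε' : ε ≤ 1 / 2) (hZ : 0 < Z) (hM : 1 ≤ M) (hMl : M ≤ Real.exp l)
    (hr : 0 ≤ r) (hrη : r * Z ^ k ≤ η)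
    (h : p ≤ Real.exp D / ((1 - ε) * Z) ^ k * M + r) :
    Real.log p ≤ l - k * Real.log Z + D + 2 * (k * ε) + η := by
  have hε1 : 0 < 1 - ε := by linarith
  have hpos : 0 < ((1 - ε) * Z) ^ k := by positivity
  have h1 : (1 - ε) ^ k ≤ 1 := pow_le_one₀ hε1.le (by linarith)
  -- The main term is at least `Z ^ (-k)`, so the additive `r` is at most `η` times the main term.
  have h2 : 1 ≤ Real.exp D / ((1 - ε) * Z) ^ k * M * Z ^ k := by
    rw [mul_pow]
    have : Real.exp D / ((1 - ε) ^ k * Z ^ k) * M * Z ^ k = Real.exp D * M / (1 - ε) ^ k := by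
      field_simp
    rw [this, one_le_div (by positivity)]
    exact h1.trans (one_le_mul_of_one_le_of_one_le (Real.one_le_exp hD) hM)
  have hA : 0 < Real.exp D / ((1 - ε) * Z) ^ k * M := by positivity
  have h3 : p ≤ Real.exp D / ((1 - ε) * Z) ^ k * M * (1 + η) := by
    have : r ≤ Real.exp D / ((1 - ε) * Z) ^ k * M * (r * Z ^ k) := by
      calc r = r * 1 := (mul_one r).symm
        _ ≤ r * (Real.exp D / ((1 - ε) * Z) ^ k * M * Z ^ k) := by gcongr
        _ = _ := by ring
    have := mul_le_mul_of_nonneg_left hrη hA.le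
    linarith
  have h4 : p ≤ Real.exp D / ((1 - ε) * Z) ^ k * Real.exp l * Real.exp η := by
    refine h3.trans ?_
    have hη : 0 ≤ η := le_trans (by positivity) hrη
    gcongr
    linarith [Real.add_one_le_exp η]
  have h5 := Real.log_le_log hp h4
  rw [Real.log_mul (by positivity) (by positivity), Real.log_mul (by positivity) (by positivity),
    Real.log_div (by positivity) hpos.ne', Real.log_pow, Real.log_mul hε1.ne' hZ.ne',
    Real.log_exp, Real.log_exp, Real.log_exp] at h5
  have h6 := mul_le_mul_of_nonneg_left (neg_two_mul_le_log_one_sub hε hε') k.cast_nonneg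
  linarith

/-- Lower bound for the logarithm of `exp (-D) / ((1 + ε) Z) ^ k * (M - η)`. -/
theorem le_log_of_exp_div_mul_le {k : ℕ} {p D ε Z M l x η : ℝ}
    (hε : 0 ≤ ε) (hZ : 0 < Z) (hM : 1 ≤ M) (hx : 0 ≤ x) (hx' : x ≤ 1 / 2)
    (hMl : Real.exp l * (1 - x) ≤ M) (hη : 0 ≤ η) (hη' : η ≤ 1 / 2)
    (h : Real.exp (-D) / ((1 + ε) * Z) ^ k * (M - η) ≤ p) :
    0 < p ∧ l - k * Real.log Z - D - k * ε - 2 * x - 2 * η ≤ Real.log p := by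
  have hx1 : 0 < 1 - x := by linarith
  have hη1 : 0 < 1 - η := by linarith
  -- Since `M ≥ 1`, subtracting `η` costs at most the factor `1 - η`.
  have h1 : Real.exp l * (1 - x) * (1 - η) ≤ M - η := by
    have := mul_le_mul_of_nonneg_right hMl hη1.le
    nlinarith
  have h2 : Real.exp (-D) / ((1 + ε) * Z) ^ k * (Real.exp l * (1 - x) * (1 - η)) ≤ p :=
    le_trans (by gcongr) h
  have h3 : 0 < Real.exp (-D) / ((1 + ε) * Z) ^ k * (Real.exp l * (1 - x) * (1 - η)) := by
    positivity
  refine ⟨h3.trans_le h2, ?_⟩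
  have h5 := Real.log_le_log h3 h2
  rw [Real.log_mul (by positivity) (by positivity), Real.log_mul (by positivity) (by positivity),
    Real.log_mul (by positivity) (by positivity),
    Real.log_div (by positivity) (by positivity), Real.log_pow,
    Real.log_mul (by positivity) hZ.ne', Real.log_exp, Real.log_exp] at h5
  have h6 := neg_two_mul_le_log_one_sub hx hx'
  have h7 := neg_two_mul_le_log_one_sub hη hη'
  have h8 : Real.log (1 + ε) ≤ ε := by
    linarith [Real.log_le_sub_one_of_pos (show 0 < 1 + ε by linarith)]
  have h9 := mul_le_mul_of_nonneg_left h8 (k.cast_nonneg (α := ℝ))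
  linarith

theorem norm_sum_sq_div_le {d k : ℕ} (hd : 0 < d) {κ : ℝ} {x : Fin k → EuclideanSpace ℝ (Fin d)}
    (hx : ∀ i, ‖x i‖ ≤ κ * √(d : ℝ)) : ‖∑ i, x i‖ ^ 2 / (2 * d) ≤ k ^ 2 * κ ^ 2 / 2 := by
  have hd' : (0 : ℝ) < d := by exact_mod_cast hd
  have h1 : ‖∑ i, x i‖ ≤ k * (κ * √(d : ℝ)) := by
    refine (norm_sum_le_of_le _ fun i _ => hx i).trans ?_
    simp
  rw [div_le_div_iff₀ (by positivity) two_pos]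
  have h2 : ‖∑ i, x i‖ ^ 2 ≤ (k * (κ * √(d : ℝ))) ^ 2 := by gcongr
  rw [mul_pow, mul_pow, Real.sq_sqrt hd'.le] at h2
  linarith

/-! ### Choice of constants and conclusion -/

theorem theorem1 (κ a : ℝ) (hκ : 0 < κ) (ha : 0 < a) :
    ∃ C : ℝ, 0 < C ∧ ∃ m : ℕ, ∀ k : ℕ, ∃ d₀ : ℕ, ∀ d : ℕ, d₀ ≤ d →
      ∀ (V : Type*) [Fintype V] [MeasurableSpace V] [MeasurableSingletonClass V]
        (v : V → EuclideanSpace ℝ (Fin d)) (Z εz ε₂ : ℝ),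
        d ≤ Fintype.card V →
        (∀ w, ‖v w‖ ≤ κ * √(d : ℝ)) →
        0 < Z → 0 ≤ εz → εz ≤ 1 / 2 → 0 ≤ ε₂ →
        PartitionConcentrates v Z εz
          (Real.exp (-a * Real.log (Fintype.card V : ℝ) ^ 2)) →
        ∀ (Ω : Type*) [MeasurableSpace Ω] (μ : Measure Ω) [IsProbabilityMeasure μ]
          (P : Kernel (DiscourseSphere d) (DiscourseSphere d)) [IsMarkovKernel P]
          (c : ℕ → Ω → DiscourseSphere d) (W : ℕ → Ω → V),
          IsRandomWalkModel v ε₂ P μ c W →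
          ∀ (s : ℕ) (u : Fin k → V),
            0 < jointProb μ W s u ∧
            |Real.log (jointProb μ W s u) -
                (‖∑ i, v (u i)‖ ^ 2 / (2 * (d : ℝ)) - (k : ℝ) * Real.log Z)| ≤
              C * ((k : ℝ) * εz) + C * (Real.log (d : ℝ) ^ m / (d : ℝ)) +
                C * ((k : ℝ) ^ 2 * ε₂) := by
  -- The `2` comes from `-log (1 - εz) ≤ 2 εz`, the `κ` from the drift of the logits. One logarithm
  -- suffices, as it only has to dominate constants depending on `k` and `κ`.
  refine ⟨2 + κ, by positivity, 1, fun k => ?_⟩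
  set Λ : ℝ := (k : ℝ) ^ 2 * κ ^ 2 / 2 with hΛ
  -- Thresholds for `log n`: `L₁` serves the second-moment error of the lower bound (with `t = √δ`,
  -- hence `a / 2`), `L₂` the bound `k δ Z ^ k ≤ 1 / d` (`Z ^ k` costs `n ^ k`), `L₃` the bound `δ ≤
  -- 1 / 2`. The further requirement `2 Λ² + 1 ≤ log d` lets `log d / d` absorb `2 l² / d + 1 / d`.
  obtain ⟨L₁, hL₁⟩ := exists_forall_mul_exp_neg_sq_le (half_pos ha) (Real.exp (4 * Λ) + k) 0
  obtain ⟨L₂, hL₂⟩ := exists_forall_mul_exp_neg_sq_le ha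
    (k * (4 * Real.exp (κ ^ 2 / 2)) ^ k) k
  obtain ⟨L₃, hL₃⟩ := exists_forall_mul_exp_neg_sq_le ha 2 0
  set L₀ := max (max L₁ L₂) (max L₃ (2 * Λ ^ 2 + 1)) with hL₀
  refine ⟨⌈Real.exp L₀⌉₊, ?_⟩
  intro d hd V _ _ _ v Z εz ε₂ hn hv hZ hεz hεz' hε₂ hconc Ω _ μ _ P _ c W hmod s u
  have hd1 : Real.exp L₀ ≤ d := (Nat.le_ceil _).trans (by exact_mod_cast hd)
  have hd0 : (0 : ℝ) < d := (Real.exp_pos _).trans_le hd1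
  have hdN : 0 < d := by exact_mod_cast hd0
  have hlogd : L₀ ≤ Real.log d := (Real.le_log_iff_exp_le hd0).2 hd1
  have hnd : (d : ℝ) ≤ Fintype.card V := by exact_mod_cast hn
  have hn0 : (0 : ℝ) < Fintype.card V := hd0.trans_le hnd
  set N : ℝ := (Fintype.card V : ℝ)
  set L := Real.log N with hL
  have hexpL : Real.exp L = N := Real.exp_log hn0
  have hL₀L : L₀ ≤ L := hlogd.trans (Real.log_le_log hd0 hnd)
  have hexpnL : Real.exp (-L) ≤ 1 / d := by
    rw [Real.exp_neg, hexpL, ← one_div]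
    exact one_div_le_one_div_of_le hd0 hnd
  have hLa := hL₁ L (((le_max_left _ _).trans (le_max_left _ _)).trans hL₀L)
  have hLb := hL₂ L (((le_max_right _ _).trans (le_max_left _ _)).trans hL₀L)
  have hLc := hL₃ L (((le_max_left _ _).trans (le_max_right _ _)).trans hL₀L)
  have hΛlog : 2 * Λ ^ 2 + 1 ≤ Real.log d :=
    ((le_max_right _ _).trans (le_max_right _ _)).trans hlogd
  have hlogle : Real.log d ≤ d - 1 := Real.log_le_sub_one_of_pos hd0
  have hd2 : 1 / (d : ℝ) ≤ 1 := by
    rw [div_le_one hd0]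
    nlinarith [sq_nonneg Λ]
  set δ := Real.exp (-a * L ^ 2) with hδ
  have hδ0 : 0 < δ := Real.exp_pos _
  set t := Real.exp (-(a / 2) * L ^ 2) with ht
  have ht0 : 0 < t := Real.exp_pos _
  have htδ : t ^ 2 = δ := by
    rw [ht, hδ, ← Real.exp_nat_mul]
    congr 1
    push_cast
    ring
  have hδ' : δ ≤ 1 / 2 := by
    rw [zero_mul, Real.exp_zero, mul_one] at hLc
    linarith
  -- the size of `Z`
  have hZN : Z ≤ 4 * Real.exp (κ ^ 2 / 2) * N := by
    have h1 := hconc.mul_le hdN hv hZ hεz'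
    -- The two halves, from `δ` and `εz` at most `1 / 2`, produce the constant `4` in the bound for
    -- `Z`.
    have h2 : 1 / 2 * (1 / 2 * Z) ≤ (1 - δ) * ((1 - εz) * Z) := by
      gcongr <;> linarith
    linarith
  have hr : k * δ * Z ^ k ≤ 1 / d := by
    refine le_trans ?_ (hLb.trans hexpnL)
    calc k * δ * Z ^ k ≤ k * δ * (4 * Real.exp (κ ^ 2 / 2) * N) ^ k := by gcongr
      _ = _ := by rw [mul_pow, Real.exp_nat_mul, hexpL]; ring
  set S := ∑ i, v (u i)
  set l := ‖S‖ ^ 2 / (2 * (d : ℝ))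
  have hl0 : 0 ≤ l := by positivity
  have hlΛ : l ≤ Λ := norm_sum_sq_div_le hdN fun i => hv (u i)
  have hl2 : l ^ 2 ≤ Λ ^ 2 := by gcongr
  have hη : t / 2 * (Real.exp (4 * l) + k) ≤ 1 / d / 2 := by
    rw [zero_mul, Real.exp_zero, mul_one] at hLa
    have h1 : t * (Real.exp (4 * l) + k) ≤ (Real.exp (4 * Λ) + k) * t := by
      rw [mul_comm]
      gcongr
    linarith
  have hM1 := one_le_integral_exp_inner_uniformSphere hdN S
  have hlow := hmod.le_jointProb hdN hε₂ hv hZ hεz ht0 (htδ ▸ hconc) s u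
  have hup := hmod.jointProb_le hdN hε₂ hv hZ hεz' hconc s u
  obtain ⟨hp, hlog1⟩ := le_log_of_exp_div_mul_le (x := l ^ 2 / d) hεz hZ hM1 (by positivity)
    (by rw [div_le_div_iff₀ hd0 two_pos]; linarith)
    (le_integral_exp_inner_uniformSphere hdN S) (by positivity) (by linarith) hlow
  have hlog2 := log_le_of_le_exp_div_mul_add hp (by positivity) hεz hεz' hZ hM1
    (integral_exp_inner_uniformSphere_le hdN S) (by positivity) hr hup
  refine ⟨hp, ?_⟩
  have hmain : 2 * (l ^ 2 / d) + 1 / d ≤ Real.log d / d := by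
    rw [← mul_div_assoc, ← add_div]
    gcongr
    linarith
  have hld0 : 0 ≤ l ^ 2 / d := by positivity
  have hlogd0 : 0 ≤ Real.log d / d := le_trans (by positivity) hmain
  have e1 : 0 ≤ k * εz := by positivity
  have e2 : 0 ≤ (k : ℝ) ^ 2 * ε₂ := by positivity
  have e3 : 0 ≤ κ * (k * εz) := by positivity
  have e4 : 0 ≤ κ * (Real.log d / d) := by positivity
  have e5 : k * (κ * k * ε₂) = κ * (k ^ 2 * ε₂) := by ring
  rw [e5] at hlog1 hlog2
  rw [pow_one, abs_le]
  constructor <;> linarith
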